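/- Let $R$ be a commutative noetherian local ring. A \emph{differential $R$-module} is an $R$-module $D$ with an $R$-linear map $\delta^D\colon D\to D$ satisfying $\delta^D\circ\delta^D=0$; its homology is the $R$-module $H(D)=\operatorname{Ker}\delta^D/\operatorname{Im}\delta^D$. Morphisms are $R$-linear maps commuting with the maps $\delta$, and $D$ is a \emph{retract} of $F$ if it is a direct summand of $F$ as a differential $R$-module. A \emph{flat flag} in a differential $R$-module $F$ is a family $(F^n)_{n\in\mathbb Z}$ of submodules with $F^n\subseteq F^{n+1}$, $F^{-1}=0$, $\bigcup_n F^n=F$ and $\delta^F(F^n)\subseteq F^{n-1}$ for all $n$, such that every $R$-module $F^n/F^{n-1}$ is flat. The \emph{flat class} of $F$ is $$\operatorname{flat\,class}_R F=\inf\{\,l\in\mathbb N : F \text{ admits a flat flag } (F^n) \text{ with } F^l=F\,\}\in\mathbb N\cup\{\infty\},$$ with $\inf\emptyset=\infty$. An $R$-module $M$, not necessarily finitely generated, is \emph{big Cohen--Macaulay} if for some system of parameters $x_1,\dots,x_d$ of $R$ (so $d=\dim R$) the element $x_i$ is not a zero divisor on $M/(x_1,\dots,x_{i-1})M$ for $i=1,\dots,d$,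 and $M\neq(x_1,\dots,x_d)M$. Theorem. Suppose that $R$ has a big Cohen--Macaulay module. (1) (Local Class Inequality) Let $F$ be a differential $R$-module and let $D$ be a retract of $F$ such that the $R$-module $H(D)$ has non-zero finite length. Then $$\operatorname{flat\,class}_R F\ \ge\ \dim R.$$ (2) (New Intersection Theorem for such rings) Let $P=(0\to P_l\to\cdots\to P_0\to 0)$ be a complex of finitely generated free $R$-modules that is not exact and such that $H_n(P)$ has finite length for every $n$. Then $l\ge\dim R$. -/

import Mathlib

/-- A differential `R`-module structure on `D`: an `R`-linear endomorphism `δ` with `δ² = 0`. -/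
structure DifferentialModule (R : Type*) [CommRing R] (D : Type*) [AddCommGroup D]
    [Module R D] where
  /-- The differentiation. -/
  δ : D →ₗ[R] D
  δ_comp_δ : δ ∘ₗ δ = 0

namespace DifferentialModule

/-- A morphism of differential modules is a linear map commuting with the differentiations. -/
def IsMorphism {R : Type*} [CommRing R]
    {D : Type*} [AddCommGroup D] [Module R D] (dD : DifferentialModule R D)
    {E : Type*} [AddCommGroup E] [Module R E] (dE : DifferentialModule R E)
    (φ : D →ₗ[R] E) : Prop :=
  dE.δ ∘ₗ φ = φ ∘ₗ dD.δ

/-- `D` is a retract of `E`, that is, a direct summand of `E` as a differential module. -/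
def IsRetract {R : Type*} [CommRing R]
    {D : Type*} [AddCommGroup D] [Module R D] (dD : DifferentialModule R D)
    {E : Type*} [AddCommGroup E] [Module R E] (dE : DifferentialModule R E) : Prop :=
  ∃ (i : D →ₗ[R] E) (π : E →ₗ[R] D),
    IsMorphism dD dE i ∧ IsMorphism dE dD π ∧ π ∘ₗ i = LinearMap.id

/-- The homology `H(D) = Ker δ / Im δ`. -/
abbrev Homology {R : Type*} [CommRing R] {D : Type*} [AddCommGroup D] [Module R D]
    (dD : DifferentialModule R D) : Type _ :=
  (LinearMap.ker dD.δ) ⧸ (LinearMap.range dD.δ).submoduleOf (LinearMap.ker dD.δ)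

/-- A differential flag in a differential module: an exhaustive increasing family of submodules
`fil n`, indexed by the integers, with `fil (-1) = 0` and `δ (fil n) ⊆ fil (n - 1)`. -/
structure Flag {R : Type*} [CommRing R] {F : Type*} [AddCommGroup F] [Module R F]
    (dF : DifferentialModule R F) where
  /-- The `n`-th submodule of the flag. -/
  fil : ℤ → Submodule R F
  fil_le : ∀ n, fil n ≤ fil (n + 1)
  fil_neg_one : fil (-1) = ⊥
  exists_mem : ∀ x, ∃ n, x ∈ fil n
  map_δ_le : ∀ n, (fil n).map dF.δ ≤ fil (n - 1)

/-- The `n`-th fold `fil n / fil (n - 1)` of a flag. -/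
abbrev Flag.Fold {R : Type*} [CommRing R] {F : Type*} [AddCommGroup F] [Module R F]
    {dF : DifferentialModule R F} (𝓕 : Flag dF) (n : ℤ) : Type _ :=
  (𝓕.fil n) ⧸ (𝓕.fil (n - 1)).submoduleOf (𝓕.fil n)

/-- A flag is flat if all its folds are flat. -/
def Flag.IsFlat {R : Type*} [CommRing R] {F : Type*} [AddCommGroup F] [Module R F]
    {dF : DifferentialModule R F} (𝓕 : Flag dF) : Prop :=
  ∀ n : ℤ, Module.Flat R (𝓕.Fold n)

/-- The flat class: the infimum of the natural numbers `l` such that there is a flat flag with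
`fil l` the whole module; it is `⊤` if there is no such `l`. -/
noncomputable def flatClass {R : Type*} [CommRing R] {F : Type*} [AddCommGroup F] [Module R F]
    (dF : DifferentialModule R F) : ℕ∞ :=
  sInf {c : ℕ∞ | ∃ l : ℕ, c = (l : ℕ∞) ∧ ∃ 𝓕 : Flag dF, 𝓕.IsFlat ∧ 𝓕.fil (l : ℤ) = ⊤}

end DifferentialModule

/-- A system of parameters of a local ring: a sequence of `dim R` elements generating an ideal
that is primary to the maximal ideal (equivalently, whose radical is the maximal ideal). -/
def IsSystemOfParameters (R : Type*) [CommRing R] [IsLocalRing R] (xs : List R) : Prop :=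
  (xs.length : WithBot ℕ∞) = ringKrullDim R ∧
    (Ideal.ofList xs).radical = IsLocalRing.maximalIdeal R

/-- `M` is a big Cohen–Macaulay module if some system of parameters `x₁, …, x_d` of `R` is a
regular sequence on `M`: each `xᵢ` is a nonzerodivisor on `M / (x₁, …, xᵢ₋₁) M`, and
`M ≠ (x₁, …, x_d) M`. No finiteness is required of `M`. -/
def IsBigCohenMacaulay (R : Type*) [CommRing R] [IsLocalRing R]
    (M : Type*) [AddCommGroup M] [Module R M] : Prop :=
  ∃ xs : List R, IsSystemOfParameters R xs ∧ RingTheory.Sequence.IsRegular M xs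

universe u v w₁ w₂ w₃

/-! Suppose F has a flat flag with F^l = F for some l < d = dim R. For a short exact sequence of
coefficients, the connecting map in homology lowers filtration by one (`Flag.exists_lift`). This is
used in two ways. Presenting coefficients by free modules, and descending the flag, shows that
x-power torsion of H(D) passes to H(D ⊗ N) for every N (`IsPowTorsion.rTensor`). Running through
x_1, …, x_d on M then shows that every class in H(D ⊗ M) comes from a cycle of filtration l - d < 0
(`exists_cycle_mem_fil`), so H(D ⊗ M) = 0.

Since M ≠ 𝔪M, some map M → k = R/𝔪 sends an element e to 1, and the map D ⊗ k → D ⊗ M ⊗ k given by e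
is split. In homology it is also zero, because it is induced by a morphism F → D → D ⊗ M into an
acyclic target; hence H(D ⊗ k) = 0 (`IsAcyclic.rTensor_quotient_of_isMaximal`). Noetherian induction
on I, with torsion in place of finite generation, gives H(D ⊗ R/I) = 0
(`IsAcyclic.rTensor_quotient`), and I = 0 contradicts H(D) ≠ 0.

A bounded complex of free modules, viewed as a differential module, is flagged by its truncations;
this yields the intersection theorem with D = F. -/

open TensorProduct CategoryTheory

/-! ### Regular sequences. -/

section RegularSequences

open scoped Pointwise

/-- A sequence that is weakly regular on both ends of a short exact sequence is weakly regular on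
the middle term. -/
theorem RingTheory.Sequence.IsWeaklyRegular.of_exact {R : Type*} [CommRing R] {xs : List R} :
    ∀ {A B C : Type*} [AddCommGroup A] [Module R A] [AddCommGroup B] [Module R B]
      [AddCommGroup C] [Module R C] {f : A →ₗ[R] B} {g : B →ₗ[R] C},
      Function.Injective f → Function.Exact f g → Function.Surjective g →
      IsWeaklyRegular A xs → IsWeaklyRegular C xs → IsWeaklyRegular B xs := by
  induction xs with
  | nil => intros; exact .nil R _
  | cons x xs ih =>
    intro A B C _ _ _ _ _ _ f g hf hfg hg hA hC
    rw [isWeaklyRegular_cons_iff] at hA hC ⊢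
    refine ⟨isSMulRegular_of_range_eq_ker hf hfg.linearMap_ker_eq.symm hA.1 hC.1, ?_⟩
    refine ih (f := QuotSMulTop.map x f) (g := QuotSMulTop.map x g) ?_
      (QuotSMulTop.map_exact x hfg hg) (QuotSMulTop.map_surjective x hg) hA.2 hC.2
    have h0 : Function.Exact (0 : A →ₗ[R] A) f := by
      intro a
      simp [map_eq_zero_iff f hf, eq_comm]
    -- Regularity of x on C keeps A/xA → B/xB injective; exactness at A is encoded by the zero map A
    -- → A.
    have := QuotSMulTop.map_first_exact_on_four_term_exact_of_isSMulRegular_last h0 hfg hC.1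
    rw [map_zero] at this
    rw [injective_iff_map_eq_zero]
    intro a ha
    obtain ⟨b, rfl⟩ := (this a).1 ha
    rfl

/-- In a weakly regular sequence the first element may be replaced by a power of it. -/
theorem RingTheory.Sequence.IsWeaklyRegular.quotSMulTop_pow {R : Type*} [CommRing R] {x : R}
    {xs : List R} {N : Type*} [AddCommGroup N] [Module R N] (h : IsWeaklyRegular N (x :: xs))
    (k : ℕ) : IsWeaklyRegular (QuotSMulTop (x ^ k) N) xs := by
  rw [isWeaklyRegular_cons_iff] at h
  induction k with
  | zero =>
    have h0 : x ^ 0 • (⊤ : Submodule R N) = ⊤ := by rw [pow_zero, one_smul]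
    have : Subsingleton (QuotSMulTop (x ^ 0) N) := Submodule.Quotient.subsingleton_iff.2 h0
    exact ⟨fun i _ => Function.injective_of_subsingleton _⟩
  | succ k ih =>
    have hle : x ^ k • (⊤ : Submodule R N) ≤
        (x ^ (k + 1) • (⊤ : Submodule R N)).comap (LinearMap.lsmul R N x) := by
      rintro _ ⟨n, -, rfl⟩
      exact ⟨n, trivial, by simp [pow_succ, smul_smul]⟩
    have hle' : x ^ (k + 1) • (⊤ : Submodule R N) ≤
        (x • (⊤ : Submodule R N)).comap LinearMap.id := by
      rintro _ ⟨n, -, rfl⟩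
      exact ⟨x ^ k • n, trivial, by simp [pow_succ, smul_smul]⟩
    -- The sequence is 0 → N/x^k → N/x^(k+1) → N/x → 0, whose first map is multiplication by x.
    refine .of_exact (f := Submodule.mapQ _ _ _ hle) (g := Submodule.mapQ _ _ _ hle') ?_ ?_ ?_ ih h.2
    · rw [injective_iff_map_eq_zero]
      intro a ha
      obtain ⟨n, rfl⟩ := Submodule.Quotient.mk_surjective _ a
      rw [Submodule.mapQ_apply, Submodule.Quotient.mk_eq_zero] at ha
      obtain ⟨m, -, hm⟩ := ha
      rw [Submodule.Quotient.mk_eq_zero]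
      refine ⟨m, trivial, h.1 ?_⟩
      simpa [pow_succ', mul_smul] using hm
    · intro b
      obtain ⟨n, rfl⟩ := Submodule.Quotient.mk_surjective _ b
      constructor
      · intro hb
        rw [Submodule.mapQ_apply, Submodule.Quotient.mk_eq_zero] at hb
        obtain ⟨m, -, hm⟩ := hb
        exact ⟨Submodule.Quotient.mk m, congrArg Submodule.Quotient.mk hm⟩
      · rintro ⟨a, ha⟩
        obtain ⟨m, rfl⟩ := Submodule.Quotient.mk_surjective _ a
        rw [← ha]
        simp only [Submodule.mapQ_apply, Submodule.Quotient.mk_eq_zero]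
        exact ⟨m, trivial, rfl⟩
    · intro c
      obtain ⟨n, rfl⟩ := Submodule.Quotient.mk_surjective _ c
      exact ⟨Submodule.Quotient.mk n, rfl⟩

end RegularSequences

/-! ### Flat modules and tensor products. -/

theorem LinearMap.lTensor_rTensor_apply {R M N P Q : Type*} [CommRing R] [AddCommGroup M]
    [Module R M] [AddCommGroup N] [Module R N] [AddCommGroup P] [Module R P] [AddCommGroup Q]
    [Module R Q] (f : M →ₗ[R] N) (g : P →ₗ[R] Q) (z : M ⊗[R] P) :
    g.lTensor N (f.rTensor P z) = f.rTensor Q (g.lTensor M z) := by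
  rw [← comp_apply, ← comp_apply, lTensor_comp_rTensor, rTensor_comp_lTensor]

/-- An extension of flat modules is flat. -/
theorem Module.Flat.of_exact {R : Type*} [CommRing R] {A B C : Type*} [AddCommGroup A] [Module R A]
    [AddCommGroup B] [Module R B] [AddCommGroup C] [Module R C] [Module.Flat R A]
    [Module.Flat R C] {f : A →ₗ[R] B} {g : B →ₗ[R] C} (hf : Function.Injective f)
    (hfg : Function.Exact f g) (hg : Function.Surjective g) : Module.Flat R B := by
  rw [Module.Flat.iff_rTensor_injective']
  intro I
  rw [injective_iff_map_eq_zero]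
  intro b hb
  have hc : g.lTensor I b = 0 := by
    refine Module.Flat.rTensor_preserves_injective_linearMap (M := C) _ I.subtype_injective ?_
    rw [← LinearMap.lTensor_rTensor_apply, hb, map_zero, map_zero]
  obtain ⟨a, rfl⟩ := (_root_.lTensor_exact I hfg hg b).1 hc
  suffices a = 0 by rw [this, map_zero]
  refine Module.Flat.rTensor_preserves_injective_linearMap (M := A) _ I.subtype_injective
    (LinearMap.lTensor_injective_of_exact_of_flat g hg f hf hfg R ?_)
  rw [LinearMap.lTensor_rTensor_apply, hb, map_zero, map_zero]

theorem Submodule.exact_inclusion_mkQ_submoduleOf {R F : Type*} [CommRing R] [AddCommGroup F]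
    [Module R F] {A B : Submodule R F} (h : A ≤ B) :
    Function.Exact (Submodule.inclusion h) (A.submoduleOf B).mkQ := by
  rw [LinearMap.exact_iff, Submodule.ker_mkQ, Submodule.range_inclusion]
  rfl

/-! ### Flat flags and lifting of cycles. -/

namespace DifferentialModule

variable {R : Type*} [CommRing R] {F : Type*} [AddCommGroup F] [Module R F]
  {dF : DifferentialModule R F} {E : Type*} [AddCommGroup E] [Module R E]
  {dE : DifferentialModule R E}

theorem Flag.fil_pred_le (𝓕 : Flag dF) (n : ℤ) : 𝓕.fil (n - 1) ≤ 𝓕.fil n := by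
  simpa using 𝓕.fil_le (n - 1)

theorem Flag.IsFlat.flat_fil {𝓕 : Flag dF} (h𝓕 : 𝓕.IsFlat) (j : ℕ) :
    Module.Flat R (𝓕.fil (-1 + j)) := by
  induction j with
  | zero =>
    rw [Nat.cast_zero, add_zero, 𝓕.fil_neg_one]
    infer_instance
  | succ j ih =>
    have := h𝓕 (-1 + (j + 1 : ℕ))
    have h : (-1 + (j + 1 : ℕ) : ℤ) - 1 = -1 + j := by push_cast; ring
    have : Module.Flat R (𝓕.fil (-1 + (j + 1 : ℕ) - 1)) := by rwa [h]
    exact .of_exact (Submodule.inclusion_injective (𝓕.fil_pred_le _))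
      (Submodule.exact_inclusion_mkQ_submoduleOf _) (Submodule.mkQ_surjective _)

theorem Flag.IsFlat.flat {𝓕 : Flag dF} (h𝓕 : 𝓕.IsFlat) {l : ℕ} (hl : 𝓕.fil l = ⊤) :
    Module.Flat R F := by
  have h := h𝓕.flat_fil (l + 1)
  rw [show (-1 + (l + 1 : ℕ) : ℤ) = l by push_cast; ring, hl] at h
  exact .of_linearEquiv (Submodule.topEquiv (R := R) (M := F)).symm

/-- Descending from F^l = F, each inclusion of one step in the next stays injective after tensoring
because its cokernel is flat. -/
theorem Flag.IsFlat.rTensor_subtype_injective {𝓕 : Flag dF} (h𝓕 : 𝓕.IsFlat) {l : ℕ}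
    (hl : 𝓕.fil l = ⊤) (N : Type*) [AddCommGroup N] [Module R N] (j : ℕ) :
    Function.Injective ((𝓕.fil (l - j)).subtype.rTensor N) := by
  induction j with
  | zero =>
    rw [Nat.cast_zero, sub_zero, hl]
    exact ((Submodule.topEquiv (R := R) (M := F)).rTensor N).injective
  | succ j ih =>
    have := h𝓕 (l - j)
    have h := LinearMap.lTensor_injective_of_exact_of_flat _ (Submodule.mkQ_surjective _) _
      (Submodule.inclusion_injective _)
      (Submodule.exact_inclusion_mkQ_submoduleOf (𝓕.fil_pred_le (l - j))) N
    rw [LinearMap.lTensor_inj_iff_rTensor_inj] at h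
    have := ih.comp h
    rw [← LinearMap.coe_comp, ← LinearMap.rTensor_comp, Submodule.subtype_comp_inclusion] at this
    rwa [show (l - (j + 1 : ℕ) : ℤ) = l - j - 1 by push_cast; ring]

/-- Lifting a cycle of filtration `n` along a short exact sequence of coefficients and applying the
differentiation gives an element of filtration `n - 1`. -/
theorem Flag.exists_lift (𝓕 : Flag dF) {A B C : Type*} [AddCommGroup A] [Module R A]
    [AddCommGroup B] [Module R B] [AddCommGroup C] [Module R C] {f : A →ₗ[R] B} {g : B →ₗ[R] C}
    (hfg : Function.Exact f g) (hg : Function.Surjective g) {n : ℤ}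
    (hinj : Function.Injective ((𝓕.fil (n - 1)).subtype.rTensor C)) {z : F ⊗[R] C}
    (hz : dF.δ.rTensor C z = 0) (hzn : z ∈ LinearMap.range ((𝓕.fil n).subtype.rTensor C)) :
    ∃ w : F ⊗[R] B, g.lTensor F w = z ∧
      ∃ y ∈ LinearMap.range ((𝓕.fil (n - 1)).subtype.rTensor A),
        f.lTensor F y = dF.δ.rTensor B w := by
  obtain ⟨c, rfl⟩ := hzn
  obtain ⟨b, rfl⟩ := LinearMap.lTensor_surjective _ hg c
  let δ' : 𝓕.fil n →ₗ[R] 𝓕.fil (n - 1) :=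
    dF.δ.restrict fun x hx => 𝓕.map_δ_le n (Submodule.mem_map_of_mem hx)
  have hδ' : (𝓕.fil (n - 1)).subtype ∘ₗ δ' = dF.δ ∘ₗ (𝓕.fil n).subtype := rfl
  -- The image of this element in F ⊗ C is δz = 0; `hinj` allows this to be tested there.
  have key : g.lTensor _ (δ'.rTensor B b) = 0 := by
    apply hinj
    rw [map_zero, ← hz, LinearMap.lTensor_rTensor_apply]
    simp only [← LinearMap.rTensor_comp_apply, hδ']
  obtain ⟨a, ha⟩ := (lTensor_exact _ hfg hg _).1 key
  refine ⟨(𝓕.fil n).subtype.rTensor B b, LinearMap.lTensor_rTensor_apply _ _ _,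
    (𝓕.fil (n - 1)).subtype.rTensor A a, ⟨a, rfl⟩, ?_⟩
  rw [LinearMap.lTensor_rTensor_apply, ha]
  simp only [← LinearMap.rTensor_comp_apply, hδ']

end DifferentialModule

/-! ### Coefficients, acyclicity and torsion. -/

namespace DifferentialModule

variable {R : Type*} [CommRing R] {F : Type*} [AddCommGroup F] [Module R F]
  {dF : DifferentialModule R F} {E : Type*} [AddCommGroup E] [Module R E]
  {dE : DifferentialModule R E}

/-- The differential module `E ⊗ N`. -/
def rTensor (dE : DifferentialModule R E) (N : Type*) [AddCommGroup N] [Module R N] :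
    DifferentialModule R (E ⊗[R] N) where
  δ := dE.δ.rTensor N
  δ_comp_δ := by rw [← LinearMap.rTensor_comp, dE.δ_comp_δ, LinearMap.rTensor_zero]

/-- The homology vanishes. -/
def IsAcyclic (dE : DifferentialModule R E) : Prop :=
  ∀ z, dE.δ z = 0 → ∃ w, dE.δ w = z

/-- Every homology class is annihilated by a power of `x`. -/
def IsPowTorsion (dE : DifferentialModule R E) (x : R) : Prop :=
  ∀ z, dE.δ z = 0 → ∃ (k : ℕ) (w : E), dE.δ w = x ^ k • z

theorem δ_apply_δ (dE : DifferentialModule R E) (z : E) : dE.δ (dE.δ z) = 0 :=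
  LinearMap.congr_fun dE.δ_comp_δ z

theorem IsMorphism.apply {p : F →ₗ[R] E} (hp : IsMorphism dF dE p) (z : F) :
    dE.δ (p z) = p (dF.δ z) :=
  LinearMap.congr_fun hp z

theorem IsMorphism.rTensor {p : F →ₗ[R] E} (hp : IsMorphism dF dE p) (N : Type*) [AddCommGroup N]
    [Module R N] : IsMorphism (dF.rTensor N) (dE.rTensor N) (p.rTensor N) := by
  have : dE.δ ∘ₗ p = p ∘ₗ dF.δ := hp
  simp only [IsMorphism, DifferentialModule.rTensor, ← LinearMap.rTensor_comp, this]

theorem isMorphism_lTensor (dE : DifferentialModule R E) {N N' : Type*} [AddCommGroup N]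
    [Module R N] [AddCommGroup N'] [Module R N'] (f : N →ₗ[R] N') :
    IsMorphism (dE.rTensor N) (dE.rTensor N') (f.lTensor E) := by
  simp only [IsMorphism, DifferentialModule.rTensor, LinearMap.rTensor_comp_lTensor,
    LinearMap.lTensor_comp_rTensor]

theorem IsAcyclic.isPowTorsion (h : dE.IsAcyclic) (x : R) : dE.IsPowTorsion x := fun z hz =>
  (h z hz).elim fun w hw => ⟨0, w, by rw [pow_zero, one_smul, hw]⟩

/-- A cycle has finitely many nonzero coordinates, each a cycle of E, so the exponents can be added
up. -/
theorem IsPowTorsion.rTensor_finsupp {x : R} (h : dE.IsPowTorsion x) (ι : Type*) :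
    (dE.rTensor (ι →₀ R)).IsPowTorsion x := by
  classical
  intro z hz
  let e := TensorProduct.finsuppScalarRight R R E ι
  have he (t : E ⊗[R] (ι →₀ R)) (i : ι) : e ((dE.rTensor (ι →₀ R)).δ t) i = dE.δ (e t i) := by
    induction t with
    | zero => simp
    | add a b ha hb => simp [ha, hb]
    | tmul a p =>
      simp [e, DifferentialModule.rTensor, TensorProduct.finsuppScalarRight_apply_tmul_apply]
  have hs (s : Finset ι) : ∃ (k : ℕ) (w : E ⊗[R] (ι →₀ R)),
      (dE.rTensor (ι →₀ R)).δ w = x ^ k • ∑ i ∈ s, e.symm (Finsupp.single i (e z i)) := by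
    induction s using Finset.induction_on with
    | empty => exact ⟨0, 0, by simp⟩
    | insert i s hi ih =>
      obtain ⟨k, w, hw⟩ := ih
      obtain ⟨m, v, hv⟩ := h (e z i) (by rw [← he, hz, map_zero, Finsupp.zero_apply])
      refine ⟨k + m, x ^ m • w + x ^ k • (v ⊗ₜ Finsupp.single i 1), ?_⟩
      rw [Finset.sum_insert hi, map_add, map_smul, map_smul, hw, smul_add, add_comm]
      congr 1
      · rw [pow_add, mul_smul]
        congr 1
        simp [e, DifferentialModule.rTensor, hv, TensorProduct.smul_tmul']
      · rw [smul_smul, ← pow_add, add_comm]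
  obtain ⟨k, w, hw⟩ := hs (e z).support
  refine ⟨k, w, ?_⟩
  rw [hw, ← map_sum]
  congr 1
  rw [LinearEquiv.symm_apply_eq]
  exact Finsupp.sum_single (e z)

/-- This is the middle of the homology exact triangle; flatness of E supplies injectivity on the
left. -/
theorem IsAcyclic.of_exact {A B C : Type*} [AddCommGroup A] [Module R A] [AddCommGroup B]
    [Module R B] [AddCommGroup C] [Module R C] [Module.Flat R E] {f : A →ₗ[R] B} {g : B →ₗ[R] C}
    (hf : Function.Injective f) (hfg : Function.Exact f g) (hg : Function.Surjective g)
    (hA : (dE.rTensor A).IsAcyclic) (hC : (dE.rTensor C).IsAcyclic) :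
    (dE.rTensor B).IsAcyclic := by
  intro z hz
  have hex := lTensor_exact E hfg hg
  obtain ⟨c, hc⟩ := hC (g.lTensor E z) (by
    rw [(dE.isMorphism_lTensor g).apply, hz, map_zero])
  obtain ⟨b, rfl⟩ := LinearMap.lTensor_surjective E hg c
  obtain ⟨a, ha⟩ := (hex (z - (dE.rTensor B).δ b)).1 (by
    rw [map_sub, ← hc, (dE.isMorphism_lTensor g).apply, sub_self])
  obtain ⟨a', rfl⟩ := hA a (by
    apply Module.Flat.lTensor_preserves_injective_linearMap (M := E) f hf
    rw [map_zero, ← (dE.isMorphism_lTensor f).apply, ha, map_sub, hz, δ_apply_δ, sub_zero])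
  refine ⟨f.lTensor E a' + b, ?_⟩
  rw [map_add, (dE.isMorphism_lTensor f).apply, ha, sub_add_cancel]

theorem lTensor_smul_id_apply (E : Type*) [AddCommGroup E] [Module R E] (N : Type*)
    [AddCommGroup N] [Module R N] (r : R) (z : E ⊗[R] N) :
    (r • LinearMap.id : N →ₗ[R] N).lTensor E z = r • z := by
  rw [LinearMap.lTensor_smul, LinearMap.lTensor_id]
  rfl

theorem eq_zero_of_mem_range_rTensor_bot {N : Type*} [AddCommGroup N] [Module R N] {z : F ⊗[R] N}
    (hz : z ∈ LinearMap.range ((⊥ : Submodule R F).subtype.rTensor N)) : z = 0 := by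
  have h : (⊥ : Submodule R F).subtype = 0 := LinearMap.ext fun y => (Submodule.mem_bot R).1 y.2
  rw [h, LinearMap.rTensor_zero, LinearMap.range_zero] at hz
  exact (Submodule.mem_bot R).1 hz

/-- If multiplication by `x` is injective on `N` with cokernel `C`, then the homology with
coefficients in `N` vanishes as soon as it is `x`-torsion and vanishes with coefficients in `C`. -/
theorem IsPowTorsion.isAcyclic_of_exact {N C : Type*} [AddCommGroup N] [Module R N]
    [AddCommGroup C] [Module R C] [Module.Flat R E] {x : R} (hx : IsSMulRegular N x)
    {g : N →ₗ[R] C} (hfg : Function.Exact (x • LinearMap.id : N →ₗ[R] N) g)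
    (hg : Function.Surjective g) (hC : (dE.rTensor C).IsAcyclic)
    (hN : (dE.rTensor N).IsPowTorsion x) : (dE.rTensor N).IsAcyclic := by
  intro z hz
  obtain ⟨k, w, hw⟩ := hN z hz
  induction k generalizing w with
  | zero => exact ⟨w, by rw [hw, pow_zero, one_smul]⟩
  | succ k ih =>
    -- If δw = x^(k+1) z, then w is a cycle over C. Subtracting a boundary makes it divisible by x,
    -- and cancelling x lowers the exponent.
    have hex := lTensor_exact E hfg hg
    obtain ⟨c, hc⟩ := hC (g.lTensor E w) (by
      rw [(dE.isMorphism_lTensor g).apply, hw, hex]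
      exact ⟨x ^ k • z, by rw [lTensor_smul_id_apply, pow_succ', mul_smul]⟩)
    obtain ⟨b, rfl⟩ := LinearMap.lTensor_surjective E hg c
    obtain ⟨t, ht⟩ := (hex (w - (dE.rTensor N).δ b)).1 (by
      rw [map_sub, ← hc, (dE.isMorphism_lTensor g).apply, sub_self])
    rw [lTensor_smul_id_apply] at ht
    refine ih t (hx.lTensor E ?_)
    change x • _ = x • _
    rw [← map_smul, ht, map_sub, δ_apply_δ, sub_zero, hw, pow_succ', mul_smul]

end DifferentialModule

/-! ### Descending the flag by connecting maps. -/

namespace DifferentialModule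

variable {R : Type u} [CommRing R] {F : Type*} [AddCommGroup F] [Module R F]
  {dF : DifferentialModule R F} {E : Type*} [AddCommGroup E] [Module R E]
  {dE : DifferentialModule R E}

/-- Dimension shifting: differentiating a lift w of z gives a cycle y over A, one filtration step
lower. A chain bounding a multiple of p(y) corrects the same multiple of p(w) to a cycle over B,
where torsion is known; its image over C is a multiple of p(z). -/
theorem IsMorphism.exists_pow_smul_rTensor_of_exact [Module.Flat R F] {𝓕 : Flag dF}
    {p : F →ₗ[R] E} (hp : IsMorphism dF dE p) {x : R} {A B C : Type*} [AddCommGroup A] [Module R A]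
    [AddCommGroup B] [Module R B] [AddCommGroup C] [Module R C] {f : A →ₗ[R] B} {g : B →ₗ[R] C}
    (hf : Function.Injective f) (hfg : Function.Exact f g) (hg : Function.Surjective g) {n : ℤ}
    (hinj : Function.Injective ((𝓕.fil (n - 1)).subtype.rTensor C))
    (hB : (dE.rTensor B).IsPowTorsion x)
    (hA : ∀ y : F ⊗[R] A, (dF.rTensor A).δ y = 0 →
      y ∈ LinearMap.range ((𝓕.fil (n - 1)).subtype.rTensor A) →
      ∃ (k : ℕ) (w : E ⊗[R] A), (dE.rTensor A).δ w = x ^ k • p.rTensor A y)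
    {z : F ⊗[R] C} (hz : (dF.rTensor C).δ z = 0)
    (hzn : z ∈ LinearMap.range ((𝓕.fil n).subtype.rTensor C)) :
    ∃ (k : ℕ) (w : E ⊗[R] C), (dE.rTensor C).δ w = x ^ k • p.rTensor C z := by
  obtain ⟨w, rfl, y, hy, hyw⟩ := 𝓕.exists_lift hfg hg hinj hz hzn
  have hy0 : (dF.rTensor A).δ y = 0 := by
    apply Module.Flat.lTensor_preserves_injective_linearMap (M := F) _ hf
    rw [map_zero, ← (dF.isMorphism_lTensor f).apply, hyw]
    exact δ_apply_δ (dF.rTensor B) w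
  obtain ⟨k, u, hu⟩ := hA y hy0 hy
  obtain ⟨m, v, hv⟩ := hB (x ^ k • p.rTensor B w - f.lTensor E u) (by
    rw [map_sub, map_smul, (hp.rTensor B).apply, (dE.isMorphism_lTensor f).apply, hu, map_smul,
      LinearMap.lTensor_rTensor_apply, hyw]
    exact sub_self _)
  refine ⟨m + k, g.lTensor E v, ?_⟩
  have h0 : g.lTensor E (f.lTensor E u) = 0 := (lTensor_exact E hfg hg _).2 ⟨u, rfl⟩
  rw [(dE.isMorphism_lTensor g).apply, hv, map_smul, map_sub, h0, sub_zero, map_smul,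
    LinearMap.lTensor_rTensor_apply, pow_add, mul_smul]

/-- A morphism from a differential module with a finite flat flag to one with `x`-torsion homology
induces, for all coefficients, a map in homology with `x`-torsion image. -/
theorem IsMorphism.exists_pow_smul_rTensor {𝓕 : Flag dF} (h𝓕 : 𝓕.IsFlat) {l : ℕ}
    (hl : 𝓕.fil l = ⊤) {p : F →ₗ[R] E} (hp : IsMorphism dF dE p) {x : R}
    (hE : dE.IsPowTorsion x) (N : Type (max u v)) [AddCommGroup N] [Module R N] (z : F ⊗[R] N)
    (hz : (dF.rTensor N).δ z = 0) :
    ∃ (k : ℕ) (w : E ⊗[R] N), (dE.rTensor N).δ w = x ^ k • p.rTensor N z := by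
  -- N must vary, since each step replaces it by the kernel of a free cover; that kernel stays in
  -- the universe `max u v`.
  suffices H : ∀ j : ℕ, j ≤ l + 1 → ∀ (N : Type (max u v)) [AddCommGroup N] [Module R N]
      (z : F ⊗[R] N), (dF.rTensor N).δ z = 0 →
      z ∈ LinearMap.range ((𝓕.fil (-1 + j)).subtype.rTensor N) →
      ∃ (k : ℕ) (w : E ⊗[R] N), (dE.rTensor N).δ w = x ^ k • p.rTensor N z by
    refine H (l + 1) le_rfl N z hz ?_
    rw [show (-1 + (l + 1 : ℕ) : ℤ) = l by push_cast; ring, hl]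
    exact LinearMap.rTensor_surjective N (fun y => ⟨⟨y, trivial⟩, rfl⟩) z
  intro j
  induction j with
  | zero =>
    intro _ N _ _ z _ hzn
    rw [Nat.cast_zero, add_zero, 𝓕.fil_neg_one] at hzn
    exact ⟨0, 0, by rw [eq_zero_of_mem_range_rTensor_bot hzn, map_zero, map_zero, smul_zero]⟩
  | succ j ih =>
    intro hj N _ _ z hz hzn
    let g : (N →₀ R) →ₗ[R] N := Finsupp.linearCombination R id
    have hg : Function.Surjective g := Finsupp.linearCombination_id_surjective R N
    have hfg : Function.Exact (LinearMap.ker g).subtype g := LinearMap.exact_subtype_ker_map g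
    have hidx : (-1 + (j + 1 : ℕ) : ℤ) - 1 = -1 + j := by push_cast; ring
    have hflat := h𝓕.flat hl
    refine hp.exists_pow_smul_rTensor_of_exact (A := LinearMap.ker g) (B := N →₀ R)
      (LinearMap.ker g).subtype_injective hfg hg ?_ (hE.rTensor_finsupp N) ?_ hz hzn
    · have := h𝓕.rTensor_subtype_injective hl N (l + 1 - j)
      rwa [hidx, show (-1 + j : ℤ) = l - (l + 1 - j : ℕ) by omega]
    · rw [hidx]
      exact ih (by omega) (LinearMap.ker g)

theorem IsPowTorsion.rTensor {𝓕 : Flag dF} (h𝓕 : 𝓕.IsFlat) {l : ℕ} (hl : 𝓕.fil l = ⊤)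
    (hr : IsRetract dE dF) {x : R} (hE : dE.IsPowTorsion x) (N : Type (max u v)) [AddCommGroup N]
    [Module R N] : (dE.rTensor N).IsPowTorsion x := by
  obtain ⟨i, π, hi, hπ, hπi⟩ := hr
  intro z hz
  obtain ⟨k, w, hw⟩ := hπ.exists_pow_smul_rTensor h𝓕 hl hE N (i.rTensor N z) (by
    rw [(hi.rTensor N).apply, hz, map_zero])
  rw [← LinearMap.rTensor_comp_apply, hπi, LinearMap.rTensor_id_apply] at hw
  exact ⟨k, w, hw⟩

/-- If the homology is torsion with respect to a weakly regular sequence of length `r` on `N`, then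
every homology class with coefficients in `N` comes from a cycle of filtration `l - r`. -/
theorem exists_cycle_mem_fil {𝓕 : Flag dF} (h𝓕 : 𝓕.IsFlat) {l : ℕ} (hl : 𝓕.fil l = ⊤)
    {i : E →ₗ[R] F} {π : F →ₗ[R] E} (hi : IsMorphism dE dF i) (hπ : IsMorphism dF dE π)
    (hπi : π ∘ₗ i = LinearMap.id) (xs : List R) (hxs : ∀ x ∈ xs, dE.IsPowTorsion x)
    (N : Type (max u v)) [AddCommGroup N] [Module R N]
    (hN : RingTheory.Sequence.IsWeaklyRegular N xs) (z : E ⊗[R] N)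
    (hz : (dE.rTensor N).δ z = 0) :
    ∃ y ∈ LinearMap.range ((𝓕.fil (l - xs.length)).subtype.rTensor N),
      (dF.rTensor N).δ y = 0 ∧ ∃ w, z = π.rTensor N y + (dE.rTensor N).δ w := by
  have hF := h𝓕.flat hl
  have hEflat : Module.Flat R E := .of_retract i π hπi
  induction xs generalizing N with
  | nil =>
    refine ⟨i.rTensor N z, ?_, ?_, 0, ?_⟩
    · rw [List.length_nil, Nat.cast_zero, sub_zero, hl]
      exact LinearMap.rTensor_surjective N (fun y => ⟨⟨y, trivial⟩, rfl⟩) _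
    · rw [(hi.rTensor N).apply, hz, map_zero]
    · rw [← LinearMap.rTensor_comp_apply, hπi, LinearMap.rTensor_id_apply, map_zero, add_zero]
  | cons x xs ih =>
    have hx := (RingTheory.Sequence.isWeaklyRegular_cons_iff N x xs).1 hN |>.1
    obtain ⟨k, w, hw⟩ := (hxs x List.mem_cons_self).rTensor.{u, v} h𝓕 hl ⟨i, π, hi, hπ, hπi⟩ N z hz
    let f : N →ₗ[R] N := x ^ k • LinearMap.id
    let g : N →ₗ[R] QuotSMulTop (x ^ k) N := Submodule.mkQ _
    have hfg : Function.Exact f g := by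
      rw [LinearMap.exact_iff, Submodule.ker_mkQ]
      ext n
      simp [f, Submodule.mem_smul_pointwise_iff_exists]
    have hg : Function.Surjective g := Submodule.mkQ_surjective _
    have hex := lTensor_exact E hfg hg
    obtain ⟨y, hy, hy0, v, hv⟩ := ih (fun a ha => hxs a (List.mem_cons_of_mem _ ha)) _
      (hN.quotSMulTop_pow k) (g.lTensor E w) (by
        rw [(dE.isMorphism_lTensor g).apply, hw, hex]
        exact ⟨z, lTensor_smul_id_apply _ _ _ _⟩)
    have hidx : (l - (x :: xs).length : ℤ) = l - xs.length - 1 := by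
      rw [List.length_cons]; push_cast; ring
    obtain ⟨b, rfl, a, ha, hab⟩ := 𝓕.exists_lift hfg hg (by
      rw [← hidx]
      exact h𝓕.rTensor_subtype_injective hl _ _) hy0 hy
    obtain ⟨c, rfl⟩ := LinearMap.lTensor_surjective E hg v
    -- Now δb = x^k a with a one step lower, and w = πb + δc + x^k t. Differentiating and cancelling
    -- x^k gives z = πa + δt.
    obtain ⟨t, ht⟩ := (hex (w - π.rTensor N b - (dE.rTensor N).δ c)).1 (by
      rw [map_sub, map_sub, hv, LinearMap.lTensor_rTensor_apply,
        (dE.isMorphism_lTensor g).apply]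
      abel)
    rw [lTensor_smul_id_apply] at hab ht
    refine ⟨a, hidx ▸ ha, ?_, t, ?_⟩
    · apply (hx.pow k).lTensor F
      change x ^ k • _ = x ^ k • _
      rw [← map_smul, hab, smul_zero]
      exact δ_apply_δ (dF.rTensor N) b
    · apply (hx.pow k).lTensor E
      change x ^ k • _ = x ^ k • _
      rw [smul_add, ← map_smul, ← map_smul, ht, hab, map_sub, map_sub, δ_apply_δ, hw, sub_zero,
        (hπ.rTensor N).apply]
      exact (add_sub_cancel _ _).symm

theorem isAcyclic_rTensor_of_isWeaklyRegular {𝓕 : Flag dF} (h𝓕 : 𝓕.IsFlat) {l : ℕ}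
    (hl : 𝓕.fil l = ⊤) (hr : IsRetract dE dF) {xs : List R}
    (hxs : ∀ x ∈ xs, dE.IsPowTorsion x) (hlen : l < xs.length) (N : Type (max u v))
    [AddCommGroup N] [Module R N] (hN : RingTheory.Sequence.IsWeaklyRegular N xs) :
    (dE.rTensor N).IsAcyclic := by
  obtain ⟨i, π, hi, hπ, hπi⟩ := hr
  intro z hz
  obtain ⟨y, hy, -, w, rfl⟩ :=
    exists_cycle_mem_fil h𝓕 hl hi hπ hπi xs hxs N hN z hz
  have hbot : 𝓕.fil (l - xs.length) = ⊥ := by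
    rw [eq_bot_iff, ← 𝓕.fil_neg_one]
    exact monotone_int_of_le_succ 𝓕.fil_le (by omega)
  rw [hbot] at hy
  exact ⟨w, by rw [eq_zero_of_mem_range_rTensor_bot hy, map_zero, zero_add]⟩

end DifferentialModule

/-! ### From M to the residue field, and from there to R. -/

namespace DifferentialModule

variable {R : Type u} [CommRing R] {F : Type*} [AddCommGroup F] [Module R F]
  {dF : DifferentialModule R F} {E : Type*} [AddCommGroup E] [Module R E]
  {dE : DifferentialModule R E}

/-- M/𝔪M is a nonzero vector space, so a functional takes the value 1 on some class. -/
theorem exists_linearMap_quotient_eq_one {m : Ideal R} (hm : m.IsMaximal) {M : Type*}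
    [AddCommGroup M] [Module R M] (hM : m • (⊤ : Submodule R M) ≠ ⊤) :
    ∃ (φ : M →ₗ[R] R ⧸ m) (e : M), φ e = 1 := by
  obtain ⟨e, -, he⟩ := SetLike.exists_of_lt hM.lt_top
  let _ := Ideal.Quotient.field m
  obtain ⟨f, hf⟩ := Module.Projective.exists_dual_eq_one (R ⧸ m)
    (x := (Submodule.Quotient.mk e : M ⧸ m • (⊤ : Submodule R M)))
    (by rwa [ne_eq, Submodule.Quotient.mk_eq_zero])
  exact ⟨f.restrictScalars R ∘ₗ Submodule.mkQ _, e, hf⟩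

/-- If the homology vanishes with coefficients in a module `M` such that `M ≠ 𝔪 M`, then it
vanishes with coefficients in `R ⧸ 𝔪`. -/
theorem IsAcyclic.rTensor_quotient_of_isMaximal {𝓕 : Flag dF} (h𝓕 : 𝓕.IsFlat) {l : ℕ}
    (hl : 𝓕.fil l = ⊤) (hr : IsRetract dE dF) {m : Ideal R} (hm : m.IsMaximal) {M : Type*}
    [AddCommGroup M] [Module R M] (hM : m • (⊤ : Submodule R M) ≠ ⊤)
    (hE : (dE.rTensor M).IsAcyclic) : (dE.rTensor (R ⧸ m)).IsAcyclic := by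
  obtain ⟨φ, e, he⟩ := exists_linearMap_quotient_eq_one hm hM
  obtain ⟨i, π, hi, hπ, hπi⟩ := hr
  let ε : E →ₗ[R] E ⊗[R] M := (TensorProduct.mk R E M).flip e
  have hp : IsMorphism dF (dE.rTensor M) (ε ∘ₗ π) := by
    ext y
    change dE.δ (π y) ⊗ₜ[R] e = π (dF.δ y) ⊗ₜ[R] e
    rw [hπ.apply]
  let ρ : (E ⊗[R] M) ⊗[R] (R ⧸ m) →ₗ[R] E ⊗[R] (R ⧸ m) :=
    (LinearMap.mul' R (R ⧸ m) ∘ₗ φ.rTensor (R ⧸ m)).lTensor E ∘ₗ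
      (TensorProduct.assoc R E M (R ⧸ m)).toLinearMap
  have hρ : IsMorphism ((dE.rTensor M).rTensor (R ⧸ m)) (dE.rTensor (R ⧸ m)) ρ := by
    refine TensorProduct.ext_threefold fun a b c => ?_
    rfl
  have hρε : ρ ∘ₗ ε.rTensor (R ⧸ m) = LinearMap.id := by
    refine TensorProduct.ext' fun a b => ?_
    change a ⊗ₜ[R] (φ e * b) = a ⊗ₜ[R] b
    rw [he, one_mul]
  intro z hz
  -- For x = 1 torsion means vanishing, so a map into the acyclic E ⊗ M remains zero in homology
  -- after tensoring with R/𝔪.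
  obtain ⟨k, w, hw⟩ := hp.exists_pow_smul_rTensor.{u, u} h𝓕 hl (hE.isPowTorsion 1) (R ⧸ m)
    (i.rTensor _ z) (by rw [(hi.rTensor _).apply, hz, map_zero])
  refine ⟨ρ w, ?_⟩
  rw [hρ.apply, hw, one_pow, one_smul, ← LinearMap.rTensor_comp_apply, LinearMap.comp_assoc, hπi,
    LinearMap.comp_id, ← LinearMap.comp_apply, hρε, LinearMap.id_apply]

theorem isAcyclic_of_subsingleton [Subsingleton E] : dE.IsAcyclic :=
  fun z _ => ⟨z, Subsingleton.elim _ _⟩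

/-- A differential module with `𝔪`-torsion homology whose homology with coefficients in the residue
field vanishes has no homology with coefficients in any cyclic module. -/
theorem IsAcyclic.rTensor_quotient [IsNoetherianRing R] [IsLocalRing R] [Module.Flat R E]
    (hk : (dE.rTensor (R ⧸ IsLocalRing.maximalIdeal R)).IsAcyclic)
    (hT : ∀ x ∈ IsLocalRing.maximalIdeal R, ∀ I : Ideal R, (dE.rTensor (R ⧸ I)).IsPowTorsion x)
    (I : Ideal R) : (dE.rTensor (R ⧸ I)).IsAcyclic := by
  induction I using WellFoundedGT.induction with
  | ind I ih =>
  by_cases htop : I = ⊤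
  · have : Subsingleton (R ⧸ I) := Ideal.Quotient.subsingleton_iff.2 htop
    exact isAcyclic_of_subsingleton
  by_cases hmI : IsLocalRing.maximalIdeal R ≤ I
  · rwa [← (IsLocalRing.maximalIdeal.isMaximal R).eq_of_le htop hmI]
  obtain ⟨x, hx, hxI⟩ := SetLike.not_le_iff_exists.1 hmI
  let g : (R ⧸ I) →ₗ[R] (R ⧸ (I ⊔ Ideal.span {x})) :=
    Submodule.mapQ I (I ⊔ Ideal.span {x}) LinearMap.id le_sup_left
  have hg : Function.Surjective g := fun c => by
    obtain ⟨r, rfl⟩ := Submodule.Quotient.mk_surjective _ c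
    exact ⟨Submodule.Quotient.mk r, rfl⟩
  have hker (r : R) : g (Submodule.Quotient.mk r) = 0 ↔
      ∃ s : R, (Submodule.Quotient.mk (x * s) : R ⧸ I) = Submodule.Quotient.mk r := by
    change (Submodule.Quotient.mk r : R ⧸ (I ⊔ Ideal.span {x})) = 0 ↔ _
    rw [Submodule.Quotient.mk_eq_zero, Submodule.mem_sup]
    constructor
    · rintro ⟨a, ha, b, hb, rfl⟩
      obtain ⟨s, rfl⟩ := Ideal.mem_span_singleton'.1 hb
      refine ⟨s, (Submodule.Quotient.eq I).2 ?_⟩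
      rw [show x * s - (a + s * x) = -a by ring]
      exact I.neg_mem ha
    · rintro ⟨s, hs⟩
      refine ⟨r - x * s, (Submodule.Quotient.eq I).1 hs.symm, x * s,
        Ideal.mem_span_singleton.2 (dvd_mul_right x s), by ring⟩
  have hC : (dE.rTensor (R ⧸ (I ⊔ Ideal.span {x}))).IsAcyclic :=
    ih _ (left_lt_sup.2 fun h => hxI (h (Ideal.mem_span_singleton_self x)))
  -- J = (I : x). If J = I, then x is regular on R/I and torsion suffices; otherwise both ends of 0
  -- → R/J → R/I → R/(I + (x)) → 0 are covered by induction.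
  let J : Ideal R := Submodule.comap (LinearMap.lsmul R R x) I
  have hIJ : I ≤ J := fun r hr => I.mul_mem_left x hr
  rcases hIJ.eq_or_lt with hJ | hJ
  · refine (hT x hx I).isAcyclic_of_exact ?_ (g := g) ?_ hg hC
    · rw [isSMulRegular_quotient_iff_mem_of_smul_mem]
      intro r hr
      rw [hJ]
      exact hr
    · intro b
      obtain ⟨r, rfl⟩ := Submodule.Quotient.mk_surjective _ b
      rw [hker]
      constructor
      · rintro ⟨s, hs⟩
        exact ⟨Submodule.Quotient.mk s, hs⟩
      · rintro ⟨a, ha⟩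
        obtain ⟨s, rfl⟩ := Submodule.Quotient.mk_surjective _ a
        exact ⟨s, ha⟩
  · refine IsAcyclic.of_exact (f := Submodule.mapQ J I (LinearMap.lsmul R R x) le_rfl) (g := g)
      ?_ ?_ hg (ih J hJ) hC
    · rw [injective_iff_map_eq_zero]
      intro a ha
      obtain ⟨s, rfl⟩ := Submodule.Quotient.mk_surjective _ a
      rw [Submodule.mapQ_apply, Submodule.Quotient.mk_eq_zero] at ha
      exact (Submodule.Quotient.mk_eq_zero _).2 ha
    · intro b
      obtain ⟨r, rfl⟩ := Submodule.Quotient.mk_surjective _ b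
      rw [hker]
      constructor
      · rintro ⟨s, hs⟩
        exact ⟨Submodule.Quotient.mk s, hs⟩
      · rintro ⟨a, ha⟩
        obtain ⟨s, rfl⟩ := Submodule.Quotient.mk_surjective _ a
        exact ⟨s, ha⟩

theorem IsAcyclic.of_rTensor {N : Type*} [AddCommGroup N] [Module R N] (e : N ≃ₗ[R] R)
    (h : (dE.rTensor N).IsAcyclic) : dE.IsAcyclic := by
  intro z hz
  obtain ⟨w, hw⟩ := h (z ⊗ₜ e.symm 1) (by
    change dE.δ z ⊗ₜ[R] e.symm 1 = 0
    rw [hz, zero_tmul])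
  let ρ : E ⊗[R] N →ₗ[R] E := (TensorProduct.rid R E).toLinearMap ∘ₗ e.toLinearMap.lTensor E
  have hρ : IsMorphism (dE.rTensor N) dE ρ := by
    refine TensorProduct.ext' fun a b => ?_
    change dE.δ (e b • a) = e b • dE.δ a
    rw [map_smul]
  refine ⟨ρ w, ?_⟩
  rw [hρ.apply, hw]
  simp [ρ]

/-- The local class inequality for a given flat flag. -/
theorem Flag.IsFlat.length_le [IsNoetherianRing R] [IsLocalRing R] {M : Type v} [AddCommGroup M]
    [Module R M] {xs : List R} (hxs : IsSystemOfParameters R xs)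
    (hM : RingTheory.Sequence.IsRegular M xs) {𝓕 : Flag dF} (h𝓕 : 𝓕.IsFlat) {l : ℕ}
    (hl : 𝓕.fil l = ⊤) (hr : IsRetract dE dF)
    (hT : ∀ x ∈ IsLocalRing.maximalIdeal R, dE.IsPowTorsion x) (hE : ¬ dE.IsAcyclic) :
    xs.length ≤ l := by
  by_contra! hlen
  have hflat : Module.Flat R E := by
    obtain ⟨i, π, -, -, hπi⟩ := hr
    have := h𝓕.flat hl
    exact .of_retract i π hπi
  have hM' : RingTheory.Sequence.IsRegular (ULift.{u} M) xs :=
    (LinearEquiv.isRegular_congr (ULift.moduleEquiv (R := R) (M := M)).symm xs).1 hM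
  have hmem : ∀ x ∈ xs, x ∈ IsLocalRing.maximalIdeal R := fun x hx => by
    rw [← hxs.2]
    exact Ideal.le_radical (Ideal.subset_span hx)
  have hne : IsLocalRing.maximalIdeal R • (⊤ : Submodule R (ULift.{u} M)) ≠ ⊤ := by
    intro h
    obtain ⟨n, hn⟩ := Ideal.exists_radical_pow_le_of_fg (Ideal.ofList xs)
      (IsNoetherian.noetherian _)
    rw [hxs.2] at hn
    -- A power of 𝔪 lies in (x_1, …, x_d), so M = 𝔪M would force M = (x_1, …, x_d)M.
    have hpow : ∀ n : ℕ, IsLocalRing.maximalIdeal R ^ n • (⊤ : Submodule R (ULift.{u} M)) = ⊤ := by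
      intro n
      induction n with
      | zero => rw [pow_zero, Ideal.one_eq_top, Submodule.top_smul]
      | succ n ih => rw [pow_succ, Submodule.mul_smul, h, ih]
    exact hM'.top_ne_smul (top_le_iff.1 ((hpow n).ge.trans (Submodule.smul_mono_left hn))).symm
  have hMacyc := isAcyclic_rTensor_of_isWeaklyRegular.{u, v} h𝓕 hl hr
    (fun x hx => hT x (hmem x hx)) hlen (ULift.{u} M) hM'.toIsWeaklyRegular
  have hk := hMacyc.rTensor_quotient_of_isMaximal h𝓕 hl hr
    (IsLocalRing.maximalIdeal.isMaximal R) hne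
  have hbot := hk.rTensor_quotient (fun x hx I => (hT x hx).rTensor.{u, u} h𝓕 hl hr (R ⧸ I)) ⊥
  exact hE (hbot.of_rTensor (Submodule.quotEquivOfEqBot ⊥ rfl))

end DifferentialModule

/-! ### Finite length homology is 𝔪-torsion. -/

/-- The chain x^k Rh stabilises, giving x^k h = x^(k+1) r h, and 1 - xr is a unit. -/
theorem IsFiniteLength.exists_pow_smul_eq_zero {R : Type*} [CommRing R] [IsLocalRing R]
    {H : Type*} [AddCommGroup H] [Module R H] (hH : IsFiniteLength R H) {x : R}
    (hx : x ∈ IsLocalRing.maximalIdeal R) (h : H) : ∃ k : ℕ, x ^ k • h = 0 := by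
  obtain ⟨_, _⟩ := isFiniteLength_iff_isNoetherian_isArtinian.1 hH
  have : IsArtinian R (Submodule.span R {h}) := inferInstance
  obtain ⟨k, ⟨y, hy⟩, hk⟩ := IsArtinian.exists_pow_succ_smul_dvd x
    (⟨h, Submodule.mem_span_singleton_self h⟩ : Submodule.span R {h})
  obtain ⟨r, rfl⟩ := Submodule.mem_span_singleton.1 hy
  have hk' : x ^ k.succ • r • h = x ^ k • h := congrArg Subtype.val hk
  refine ⟨k, ?_⟩
  have hu : IsUnit (1 - x * r) := by
    by_contra hu
    refine (IsLocalRing.maximalIdeal.isMaximal R).ne_top ((Ideal.eq_top_iff_one _).2 ?_)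
    have := Ideal.add_mem _ ((IsLocalRing.mem_maximalIdeal _).2 hu) (Ideal.mul_mem_right r _ hx)
    rwa [sub_add_cancel] at this
  refine (hu.smul_eq_zero).1 ?_
  calc (1 - x * r) • x ^ k • h = x ^ k • h - x ^ k.succ • r • h := by
        rw [smul_smul, smul_smul, ← sub_smul]
        congr 1
        rw [Nat.succ_eq_add_one, pow_succ]
        ring
    _ = 0 := by rw [hk', sub_self]

namespace DifferentialModule

theorem isPowTorsion_of_isFiniteLength {R : Type*} [CommRing R] [IsLocalRing R] {D : Type*}
    [AddCommGroup D] [Module R D] {dD : DifferentialModule R D}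
    (h : IsFiniteLength R dD.Homology) {x : R} (hx : x ∈ IsLocalRing.maximalIdeal R) :
    dD.IsPowTorsion x := by
  intro z hz
  obtain ⟨k, hk⟩ := h.exists_pow_smul_eq_zero hx
    (Submodule.Quotient.mk (⟨z, hz⟩ : LinearMap.ker dD.δ))
  rw [← Submodule.Quotient.mk_smul, Submodule.Quotient.mk_eq_zero] at hk
  obtain ⟨w, hw⟩ := hk
  exact ⟨k, w, hw⟩

theorem not_isAcyclic_of_nontrivial {R : Type*} [CommRing R] {D : Type*}
    [AddCommGroup D] [Module R D] {dD : DifferentialModule R D} (h : Nontrivial dD.Homology) :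
    ¬ dD.IsAcyclic := by
  intro hac
  obtain ⟨a, ha⟩ := exists_ne (0 : dD.Homology)
  obtain ⟨⟨z, hz⟩, rfl⟩ := Submodule.Quotient.mk_surjective _ a
  obtain ⟨w, hw⟩ := hac z hz
  exact ha ((Submodule.Quotient.mk_eq_zero _).2 ⟨w, hw⟩)

end DifferentialModule

/-- A cycle of a short complex of modules over a local ring whose homology has finite length becomes
a boundary after multiplication by a power of any element of the maximal ideal. -/
theorem CategoryTheory.ShortComplex.exists_pow_smul_eq_of_isFiniteLength {R : Type u} [CommRing R]
    [IsLocalRing R] (S : ShortComplex (ModuleCat.{w₃} R)) (h : IsFiniteLength R S.homology) {x : R}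
    (hx : x ∈ IsLocalRing.maximalIdeal R) (y : S.X₂) (hy : S.g y = 0) :
    ∃ (k : ℕ) (w : S.X₁), S.f w = x ^ k • y := by
  have h' := S.moduleCatHomologyIso.toLinearEquiv.isFiniteLength h
  obtain ⟨k, hk⟩ := h'.exists_pow_smul_eq_zero hx
    (Submodule.Quotient.mk (⟨y, hy⟩ : LinearMap.ker S.g.hom) :
      LinearMap.ker S.g.hom ⧸ LinearMap.range S.moduleCatToCycles)
  have hk' := (Submodule.Quotient.mk_eq_zero (LinearMap.range S.moduleCatToCycles)
    (x := x ^ k • (⟨y, hy⟩ : LinearMap.ker S.g.hom))).1 hk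
  obtain ⟨w, hw⟩ := hk'
  exact ⟨k, w, congrArg Subtype.val hw⟩

/-! ### Bounded complexes as flagged differential modules. -/

namespace ChainComplex

variable {R : Type u} [CommRing R] (P : ChainComplex (ModuleCat.{w₃} R) ℕ)

theorem next_down_nat (n : ℕ) : (ComplexShape.down ℕ).next n = n - 1 := by
  cases n <;> simp

theorem exists_pow_smul_eq_of_isFiniteLength_homology [IsLocalRing R] (n : ℕ)
    (h : IsFiniteLength R (P.homology n)) {x : R} (hx : x ∈ IsLocalRing.maximalIdeal R)
    (y : P.X n) (hy : P.d n (n - 1) y = 0) :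
    ∃ (k : ℕ) (w : P.X (n + 1)), P.d (n + 1) n w = x ^ k • y :=
  (P.sc' (n + 1) n (n - 1)).exists_pow_smul_eq_of_isFiniteLength
    ((P.homologyIsoSc' (n + 1) n (n - 1) (by simp)
      (next_down_nat n)).toLinearEquiv.isFiniteLength h) hx y hy

/-- The differential module underlying a chain complex, on the product of its terms. -/
def toDifferentialModule : DifferentialModule R (∀ n, P.X n) where
  δ := LinearMap.pi fun n => (P.d (n + 1) n).hom ∘ₗ LinearMap.proj (n + 1)
  δ_comp_δ := by
    refine LinearMap.ext fun z => funext fun n => ?_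
    exact congr($(P.d_comp_d (n + 1 + 1) (n + 1) n) (z (n + 1 + 1)))

theorem toDifferentialModule_δ_apply (z : ∀ n, P.X n) (n : ℕ) :
    P.toDifferentialModule.δ z n = P.d (n + 1) n (z (n + 1)) := rfl

theorem d_apply_eq_zero_of_δ_eq_zero {z : ∀ n, P.X n} (hz : P.toDifferentialModule.δ z = 0)
    (n : ℕ) : P.d n (n - 1) (z n) = 0 := by
  cases n with
  | zero => rw [P.shape 0 (0 - 1) (by simp)]; rfl
  | succ n => exact congrFun hz n

theorem isPowTorsion_toDifferentialModule [IsLocalRing R] {l : ℕ}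
    (hl : ∀ n, l < n → Subsingleton (P.X n)) (h : ∀ n, IsFiniteLength R (P.homology n)) {x : R}
    (hx : x ∈ IsLocalRing.maximalIdeal R) : P.toDifferentialModule.IsPowTorsion x := by
  intro z hz
  choose k w hw using fun n => P.exists_pow_smul_eq_of_isFiniteLength_homology n (h n) hx (z n)
    (P.d_apply_eq_zero_of_δ_eq_zero hz n)
  -- Boundedness permits one exponent for all degrees. The degree 0 entry of `v` is arbitrary, since
  -- δ ignores it.
  let K := (Finset.range (l + 1)).sup k
  let v : ∀ n, P.X n := fun
    | 0 => 0
    | n + 1 => x ^ (K - k n) • w n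
  refine ⟨K, v, funext fun n => ?_⟩
  rcases lt_or_ge l n with hn | hn
  · have := hl n hn
    exact Subsingleton.elim _ _
  · have hk : k n ≤ K := Finset.le_sup (f := k) (Finset.mem_range.2 (Nat.lt_succ_of_le hn))
    change P.d (n + 1) n (x ^ (K - k n) • w n) = x ^ K • z n
    rw [map_smul, hw, smul_smul, ← pow_add, Nat.sub_add_cancel hk]

theorem acyclic_of_isAcyclic (h : P.toDifferentialModule.IsAcyclic) : P.Acyclic := by
  classical
  intro n
  rw [P.exactAt_iff' (n + 1) n (n - 1) (by simp) (next_down_nat n),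
    ShortComplex.moduleCat_exact_iff]
  intro (y : P.X n) (hy : P.d n (n - 1) y = 0)
  obtain ⟨w, hw⟩ := h (Pi.single n y) (by
    funext m
    rw [toDifferentialModule_δ_apply]
    by_cases hm : m + 1 = n
    · subst hm
      rw [Pi.single_eq_same]
      exact hy
    · rw [Pi.single_eq_of_ne hm, map_zero]
      rfl)
  refine ⟨w (n + 1), ?_⟩
  have := congrFun hw n
  rwa [Pi.single_eq_same] at this

/-- The submodule of families that vanish in degrees above `k`. -/
def truncation (k : ℤ) : Submodule R (∀ n, P.X n) where
  carrier := {z | ∀ n : ℕ, k < n → z n = 0}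
  add_mem' ha hb n hn := by rw [Pi.add_apply, ha n hn, hb n hn, add_zero]
  zero_mem' _ _ := rfl
  smul_mem' c z hz n hn := by rw [Pi.smul_apply, hz n hn, smul_zero]

theorem truncation_eq_top {l : ℕ} (hl : ∀ n, l < n → Subsingleton (P.X n)) :
    P.truncation l = ⊤ := by
  rw [eq_top_iff]
  intro z _ n hn
  have := hl n (by exact_mod_cast hn)
  exact Subsingleton.elim _ _

/-- The flag of truncations of a bounded chain complex. -/
def flag {l : ℕ} (hl : ∀ n, l < n → Subsingleton (P.X n)) :
    DifferentialModule.Flag P.toDifferentialModule where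
  fil := P.truncation
  fil_le k z hz n hn := hz n (by omega)
  fil_neg_one := by
    rw [eq_bot_iff]
    intro z hz
    exact funext fun n => hz n (by omega)
  exists_mem z := ⟨l, by rw [P.truncation_eq_top hl]; trivial⟩
  map_δ_le k := by
    rintro _ ⟨z, hz, rfl⟩ n hn
    rw [toDifferentialModule_δ_apply, hz (n + 1) (by push_cast; omega), map_zero]

theorem isFlat_flag [∀ n, Module.Flat R (P.X n)] {l : ℕ} (hl : ∀ n, l < n → Subsingleton (P.X n)) :
    (P.flag hl).IsFlat := by
  classical
  intro k
  rcases lt_or_ge k 0 with hk | hk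
  · have : Subsingleton ((P.flag hl).fil k) :=
      ⟨fun a b => Subtype.ext (funext fun n => (a.2 n (by omega)).trans (b.2 n (by omega)).symm)⟩
    change Module.Flat R (_ ⧸ _)
    infer_instance
  · obtain ⟨n, rfl⟩ := Int.eq_ofNat_of_zero_le hk
    -- Projection to degree n identifies the n-th fold with P_n.
    let q : (P.flag hl).fil n →ₗ[R] P.X n := LinearMap.proj n ∘ₗ Submodule.subtype _
    have hq : Function.Surjective q := by
      intro y
      refine ⟨⟨Pi.single (M := fun m => P.X m) n y, fun m hm => ?_⟩, ?_⟩
      · exact Pi.single_eq_of_ne (by omega) _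
      · exact Pi.single_eq_same (M := fun m => P.X m) n y
    have hker : LinearMap.ker q = ((P.flag hl).fil (n - 1)).submoduleOf ((P.flag hl).fil n) := by
      ext z
      constructor
      · intro hz m hm
        rcases eq_or_ne m n with rfl | hmn
        · exact hz
        · exact z.2 m (by omega)
      · intro hz
        exact hz n (by omega)
    exact .of_linearEquiv ((Submodule.quotEquivOfEq _ _ hker.symm).trans
      (q.quotKerEquivOfSurjective hq))

end ChainComplex

/-- The local Class Inequality, together with the New Intersection Theorem, for local rings that
have a big Cohen–Macaulay module. -/
theorem mainTheorem1
    {R : Type u} [CommRing R] [IsNoetherianRing R] [IsLocalRing R]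
    {M : Type v} [AddCommGroup M] [Module R M] (hM : IsBigCohenMacaulay R M) :
    (∀ (F : Type w₁) [AddCommGroup F] [Module R F] (dF : DifferentialModule R F)
        (D : Type w₂) [AddCommGroup D] [Module R D] (dD : DifferentialModule R D),
        dD.IsRetract dF →
        IsFiniteLength R dD.Homology → Nontrivial dD.Homology →
        ringKrullDim R ≤ (dF.flatClass : WithBot ℕ∞)) ∧
    (∀ (P : ChainComplex (ModuleCat.{w₃} R) ℕ) (l : ℕ),
        (∀ n, Module.Free R (P.X n)) → (∀ n, Module.Finite R (P.X n)) →
        (∀ n, l < n → Subsingleton (P.X n)) →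
        ¬ P.Acyclic → (∀ n, IsFiniteLength R (P.homology n)) →
        ringKrullDim R ≤ (l : WithBot ℕ∞)) := by
  obtain ⟨xs, hxs, hreg⟩ := hM
  rw [← hxs.1]
  constructor
  · intro F _ _ dF D _ _ dD hr hfin hnt
    have : (xs.length : ℕ∞) ≤ dF.flatClass := by
      refine le_sInf ?_
      rintro _ ⟨l, rfl, 𝓕, h𝓕, hl⟩
      exact_mod_cast h𝓕.length_le hxs hreg hl hr
        (fun x hx => DifferentialModule.isPowTorsion_of_isFiniteLength hfin hx)
        (DifferentialModule.not_isAcyclic_of_nontrivial hnt)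
    exact_mod_cast this
  · intro P l hfree _ hl hP hfin
    have hflat n : Module.Flat R (P.X n) := by
      have := hfree n
      infer_instance
    have hr : P.toDifferentialModule.IsRetract P.toDifferentialModule :=
      ⟨LinearMap.id, LinearMap.id, rfl, rfl, rfl⟩
    exact_mod_cast (P.isFlat_flag hl).length_le hxs hreg (P.truncation_eq_top hl) hr
      (fun x hx => P.isPowTorsion_toDifferentialModule hl hfin hx)
      (mt P.acyclic_of_isAcyclic hP)
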